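/- Consider $\dot x=f(x,r(t))$ in $\mathbb R^n$, where $r$ is a staircase signal: $r(t)=\xi_i\in\mathbb R$ for $\tau_i\le t<\tau_{i+1}$, $i=0,1,\dots$, with $0=\tau_0<\tau_1<\cdots$, $\tau_i\to\infty$; put $\Delta_i=\tau_{i+1}-\tau_i$. Let $C\subset\mathbb R^n$. On $C$, let $f$ be continuous in $(x,r)$ on the values of the signal, continuously differentiable in $x$ (near each point of $C$) for each value of the signal, and $|f(x,r(t))|\le m(t)$ for all $x\in C$, $t\ge0$, with a Lebesgue measurable $m$. Solutions are Carathéodory solutions (continuous solutions of the integral equation). Let $C$ be forward invariant: for all $t_0\ge 0$ and $x_0\in C$ the solution with $x(t_0)=x_0$ exists and lies in $C$ for all $t\ge t_0$. For every mode let a norm $|\cdot|_{\xi_i}$ on $\mathbb R^n$ be given, uniformly equivalent: there is $D>0$ with $|x|_{\xi_i}\le D|x|_{\xi_j}$ for all $i,j,x$. Let $C$ be $\kappa$-reachable: for each $t_0\ge0$ there is $\kappa>0$ such that any $x_0,y_0\in C$ are joined by a $C^1$ curve $\gamma:[0,1]\to C$, $\gamma(0)=x_0$, $\gamma(1)=y_0$,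 with $|\gamma'(s)|_{r(t_0)}\le\kappa|x_0-y_0|_{r(t_0)}$ for all $s\in[0,1]$. Let $\mu_\chi(A)=\lim_{h\to0+}(|I+hA|_\chi-1)/h$, with the matrix norm induced by $|\cdot|_\chi$. Let $\alpha_j\in\mathbb R$, $\beta_j\ge0$ ($j\ge 0$), $c>0$, $T_0>0$ be such that, for all $j$, $$\mu_{\xi_j}\Big(\frac{\partial f}{\partial x}(x,\xi_j)\Big)\le\alpha_j\quad\text{for all }x\in C,\qquad |\cdot|_{\xi_{j+1}}\le\beta_j|\cdot|_{\xi_j}.$$ For $t_0\ge0$ and $T>0$ let $k$ be the index with $\tau_k\le t_0<\tau_{k+1}$, let $m=k+\#\{i:\ t_0<\tau_i<t_0+T\}$, and consider the condition $$\frac1T\Big\{\sum_{i=k}^{m-1}\big[\alpha_i\Delta_i+\log\beta_i\big]+\alpha_m\,[t_0+T-\tau_m]-\alpha_k\,[t_0-\tau_k]\Big\}<-c.\qquad(*)$$ 1. If there is $t_0\ge0$ (for instance $t_0=\tau_0=0$) such that $(*)$ holds for all $T>T_0$, then the system is incrementally exponentially asymptotically stable ($\delta$EAS) in $C$ with rate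 $c$: for some norm $|\cdot|$ and every starting time $s\ge0$ there is a class $\mathcal{KL}$ function $b_s(\rho,t)$ on $[0,\infty)^2$ (continuous, nonnegative, strictly increasing in $\rho$ with $b_s(0,t)=0$, nonincreasing in $t$ with limit $0$ as $t\to\infty$) with $b_s(\rho,t)=O(e^{-ct})$ as $t\to\infty$ for each $\rho$, such that any two solutions $x,y$ starting in $C$ at time $s$ satisfy $|x(s+t)-y(s+t)|\le b_s(|x(s)-y(s)|,t)$ for all $t\ge0$. 2. If $(*)$ holds for all $t_0\ge0$ and all $T>T_0$ (with the same $c$ and $T_0$), and the $\alpha_j$ are bounded below, then the system is $\delta$UEAS in $C$ with rate $c$: in 1. the function $b_s$ can be chosen independently of $s$. -/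

import Mathlib

open Set Filter Topology MeasureTheory

/-- A seminorm on `ℝⁿ` that is a norm. -/
def IsNorm {n : ℕ} (p : Seminorm ℝ (EuclideanSpace ℝ (Fin n))) : Prop :=
  ∀ x, p x = 0 → x = 0

/-- The matrix norm `|B| = sup_{|x| = 1} |B x|` induced by the vector norm `p`. -/
noncomputable def inducedNorm {n : ℕ} (p : Seminorm ℝ (EuclideanSpace ℝ (Fin n)))
    (B : EuclideanSpace ℝ (Fin n) →L[ℝ] EuclideanSpace ℝ (Fin n)) : ℝ :=
  sSup {a | ∃ x, p x = 1 ∧ a = p (B x)}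

/-- The matrix measure `μ(A) = lim_{h → 0+} (|I + h A| - 1) / h` induced by the vector norm `p`. -/
noncomputable def matrixMeasure {n : ℕ} (p : Seminorm ℝ (EuclideanSpace ℝ (Fin n)))
    (A : EuclideanSpace ℝ (Fin n) →L[ℝ] EuclideanSpace ℝ (Fin n)) : ℝ :=
  limUnder (𝓝[>] (0 : ℝ)) fun h : ℝ =>
    (inducedNorm p (ContinuousLinearMap.id ℝ (EuclideanSpace ℝ (Fin n)) + h • A) - 1) / h

/-- `r` is the staircase signal with value `ξ i` on `[τ i, τ (i+1))`, where the times `τ i`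
increase strictly from `τ 0 = 0` to infinity. -/
structure IsStaircase (r : ℝ → ℝ) (τ : ℕ → ℝ) (ξ : ℕ → ℝ) : Prop where
  zero : τ 0 = 0
  strictMono : StrictMono τ
  tendsto : Tendsto τ atTop atTop
  eq : ∀ i, ∀ t ∈ Ico (τ i) (τ (i + 1)), r t = ξ i

/-- Regularity of the vector field on `C` for the signal `r`: joint continuity in `(x, r)`, for each
value of the signal continuous differentiability in `x` (on a neighbourhood of every point of `C`,
so that the Jacobian makes sense on sets that are not open), and a bound depending on time only. -/
structure RegularField {n : ℕ}
    (f : EuclideanSpace ℝ (Fin n) → ℝ → EuclideanSpace ℝ (Fin n)) (r : ℝ → ℝ)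
    (C : Set (EuclideanSpace ℝ (Fin n))) : Prop where
  continuousOn : ContinuousOn (fun z : EuclideanSpace ℝ (Fin n) × ℝ => f z.1 z.2)
    (C ×ˢ (r '' Ici 0))
  contDiffAt : ∀ x ∈ C, ∀ t, 0 ≤ t → ContDiffAt ℝ 1 (fun y => f y (r t)) x
  bound : ∃ m : ℝ → ℝ, AEMeasurable m volume ∧ ∀ x ∈ C, ∀ t, 0 ≤ t → ‖f x (r t)‖ ≤ m t

/-- `x` is a Carathéodory solution of `x' = f (x, r(t))` on `[t₀, ∞)`: it is continuous and satisfies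
the equivalent integral equation. -/
def IsSolution {n : ℕ}
    (f : EuclideanSpace ℝ (Fin n) → ℝ → EuclideanSpace ℝ (Fin n)) (r : ℝ → ℝ) (t₀ : ℝ)
    (x : ℝ → EuclideanSpace ℝ (Fin n)) : Prop :=
  ContinuousOn x (Ici t₀) ∧
    ∀ t, t₀ ≤ t → IntervalIntegrable (fun s => f (x s) (r s)) volume t₀ t ∧
      x t = x t₀ + ∫ s in t₀..t, f (x s) (r s)

/-- `C` is forward invariant: from each point of `C` at each time `t₀ ≥ 0` there starts a solution
that exists and stays in `C` for all later times. (For regular fields, it is the only solution.) -/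
def ForwardInvariant {n : ℕ}
    (f : EuclideanSpace ℝ (Fin n) → ℝ → EuclideanSpace ℝ (Fin n)) (r : ℝ → ℝ)
    (C : Set (EuclideanSpace ℝ (Fin n))) : Prop :=
  ∀ t₀, 0 ≤ t₀ → ∀ x₀ ∈ C, ∃ x, IsSolution f r t₀ x ∧ x t₀ = x₀ ∧ ∀ t, t₀ ≤ t → x t ∈ C

/-- `C` is `κ`-reachable with respect to the norm `p`. -/
def IsReachable {n : ℕ} (p : Seminorm ℝ (EuclideanSpace ℝ (Fin n))) (κ : ℝ)
    (C : Set (EuclideanSpace ℝ (Fin n))) : Prop :=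
  ∀ x₀ ∈ C, ∀ y₀ ∈ C, ∃ γ : ℝ → EuclideanSpace ℝ (Fin n),
    ContDiffOn ℝ 1 γ (Icc 0 1) ∧ MapsTo γ (Icc 0 1) C ∧ γ 0 = x₀ ∧ γ 1 = y₀ ∧
      ∀ s ∈ Icc (0 : ℝ) 1, p (derivWithin γ (Icc 0 1) s) ≤ κ * p (x₀ - y₀)

/-- Functions of class `KL` on `[0, ∞) × [0, ∞)`. -/
structure IsClassKL (b : ℝ → ℝ → ℝ) : Prop where
  continuousOn : ContinuousOn (fun z : ℝ × ℝ => b z.1 z.2) (Ici 0 ×ˢ Ici 0)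
  nonneg : ∀ ρ t, 0 ≤ ρ → 0 ≤ t → 0 ≤ b ρ t
  zero : ∀ t, 0 ≤ t → b 0 t = 0
  strictMonoOn : ∀ t, 0 ≤ t → StrictMonoOn (fun ρ => b ρ t) (Ici 0)
  antitoneOn : ∀ ρ, 0 ≤ ρ → AntitoneOn (b ρ) (Ici 0)
  tendsto : ∀ ρ, 0 ≤ ρ → Tendsto (b ρ) atTop (𝓝 0)

/-- Functions of class `EKL` with exponential rate `c`: of class `KL` and `O(exp(-c t))` in `t`. -/
def IsClassEKL (c : ℝ) (b : ℝ → ℝ → ℝ) : Prop :=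
  IsClassKL b ∧ ∀ ρ, 0 ≤ ρ → (b ρ) =O[atTop] fun t => Real.exp (-c * t)

/-- In the norm `p`, any two solutions that start in `C` at time `t₀` have at time `t₀ + t` a
distance of at most `b d t`, where `d` is their distance at time `t₀`. -/
def IncrementalBound {n : ℕ}
    (f : EuclideanSpace ℝ (Fin n) → ℝ → EuclideanSpace ℝ (Fin n)) (r : ℝ → ℝ)
    (C : Set (EuclideanSpace ℝ (Fin n))) (p : Seminorm ℝ (EuclideanSpace ℝ (Fin n)))
    (b : ℝ → ℝ → ℝ) (t₀ : ℝ) : Prop :=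
  ∀ x y : ℝ → EuclideanSpace ℝ (Fin n), IsSolution f r t₀ x → IsSolution f r t₀ y →
    x t₀ ∈ C → y t₀ ∈ C → ∀ t, 0 ≤ t → p (x (t₀ + t) - y (t₀ + t)) ≤ b (p (x t₀ - y t₀)) t

/-- Incremental exponential asymptotic stability in `C` with rate `c`; the bound may depend on the
initial time. -/
def DeltaEAS {n : ℕ}
    (f : EuclideanSpace ℝ (Fin n) → ℝ → EuclideanSpace ℝ (Fin n)) (r : ℝ → ℝ)
    (C : Set (EuclideanSpace ℝ (Fin n))) (c : ℝ) : Prop :=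
  ∃ p : Seminorm ℝ (EuclideanSpace ℝ (Fin n)), IsNorm p ∧
    ∀ t₀, 0 ≤ t₀ → ∃ b, IsClassEKL c b ∧ IncrementalBound f r C p b t₀

/-- Incremental uniform exponential asymptotic stability in `C` with rate `c`: the bound does not
depend on the initial time. -/
def DeltaUEAS {n : ℕ}
    (f : EuclideanSpace ℝ (Fin n) → ℝ → EuclideanSpace ℝ (Fin n)) (r : ℝ → ℝ)
    (C : Set (EuclideanSpace ℝ (Fin n))) (c : ℝ) : Prop :=
  ∃ p : Seminorm ℝ (EuclideanSpace ℝ (Fin n)), IsNorm p ∧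
    ∃ b, IsClassEKL c b ∧ ∀ t₀, 0 ≤ t₀ → IncrementalBound f r C p b t₀

/-- The index of the mode that is active at time `s`, the largest `i` with `τ i ≤ s`. -/
noncomputable def modeIndex (τ : ℕ → ℝ) (s : ℝ) : ℕ := sSup {i | τ i ≤ s}

/-- The number of switching times in the open interval `(s, t)`. -/
noncomputable def switchCount (τ : ℕ → ℝ) (s t : ℝ) : ℕ := {i | s < τ i ∧ τ i < t}.ncard

/-- The exponent collected from time `t₀` to time `t₀ + T`: the integral of the staircase function
with values `α i`, plus `log (β i)` for each switch from mode `i` to mode `i + 1` in between. The last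
term removes the part of the first mode before `t₀`; it vanishes if `t₀` is a switching time. -/
noncomputable def totalExponent (τ α β : ℕ → ℝ) (t₀ T : ℝ) : ℝ :=
  let k := modeIndex τ t₀
  let m := k + switchCount τ t₀ (t₀ + T)
  (∑ i ∈ Finset.Ico k m, (α i * (τ (i + 1) - τ i) + Real.log (β i)))
    + α m * (t₀ + T - τ m) - α k * (t₀ - τ k)

/-! During mode `i` the matrix measure lets nearby solutions separate at rate at most `α i`, and the
switch that ends the mode changes the norm at the cost of a factor `β i`. So nearby solutions
separate at most by the exponential of the accumulated exponent. Join two initial points by a curve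
in `C` and move it with the flow: its length grows by at most the same factor, which bounds the
distance of the end points up to `κ` and a factor `D` for each of two changes of norm.

No variational equation is needed. Around a solution in `C`, `exists_forall_seminorm_sub_le` gives a
local Lipschitz estimate with exponent off by `ε`;
`IsStaircase.exists_forall_solution_sub_le_modeExponent` chains these over the modes. The mean value
inequality `Seminorm.sub_le_of_eventually_le` along the curve and `ε → 0` give
`IsStaircase.seminorm_solution_sub_le`.

It remains to bound the exponent from `s` to `s + t` by `M - c * t`. In part 1 it differs by a
constant from the exponent counted from the given time, and only finitely many modes matter before
the condition takes effect. In part 2 a short interval is extended to length `2 * T₀`, where the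
condition applies; the added piece is bounded below through the lower bound on `α` and the
equivalence of the norms. -/

/-! ### Induced norms and matrix measures -/

section InducedNorm

variable {n : ℕ} {p : Seminorm ℝ (EuclideanSpace ℝ (Fin n))}

theorem Seminorm.continuous_euclideanSpace (p : Seminorm ℝ (EuclideanSpace ℝ (Fin n))) :
    Continuous p := by
  have := ConvexOn.continuousOn isOpen_univ p.convexOn
  exact continuousOn_univ.1 this

theorem Seminorm.exists_le_mul_norm (p : Seminorm ℝ (EuclideanSpace ℝ (Fin n))) :
    ∃ A : ℝ, 0 < A ∧ ∀ x, p x ≤ A * ‖x‖ :=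
  p.bound_of_continuous_normedSpace p.continuous_euclideanSpace

theorem IsNorm.exists_norm_le_mul (hp : IsNorm p) : ∃ B : ℝ, 0 < B ∧ ∀ x, ‖x‖ ≤ B * p x := by
  rcases (Metric.sphere (0 : EuclideanSpace ℝ (Fin n)) 1).eq_empty_or_nonempty with h | h
  · refine ⟨1, one_pos, fun x => ?_⟩
    have hx : x = 0 := by
      by_contra hx
      have : (‖x‖⁻¹ • x) ∈ Metric.sphere (0 : EuclideanSpace ℝ (Fin n)) 1 := by
        simp [norm_smul, hx]
      simp [h] at this
    simp [hx]
  · obtain ⟨x₀, hx₀, hmin⟩ := (isCompact_sphere (0 : EuclideanSpace ℝ (Fin n)) 1).exists_isMinOn h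
      p.continuous_euclideanSpace.continuousOn
    have hpos : 0 < p x₀ := by
      refine lt_of_le_of_ne (apply_nonneg p x₀) fun h0 => ?_
      have := hp x₀ h0.symm
      simp [this] at hx₀
    refine ⟨(p x₀)⁻¹, inv_pos.2 hpos, fun x => ?_⟩
    by_cases hx : x = 0
    · simp [hx]
    have hx' : 0 < ‖x‖ := norm_pos_iff.2 hx
    have h1 : p x₀ ≤ p (‖x‖⁻¹ • x) := hmin (by simp [norm_smul, hx])
    rw [map_smul_eq_mul, norm_inv, norm_norm] at h1
    rw [inv_mul_eq_div, le_div_iff₀ hpos]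
    calc ‖x‖ * p x₀ ≤ ‖x‖ * (‖x‖⁻¹ * p x) := by gcongr
      _ = p x := by field_simp

theorem bddAbove_inducedNorm (hp : IsNorm p)
    (B : EuclideanSpace ℝ (Fin n) →L[ℝ] EuclideanSpace ℝ (Fin n)) :
    BddAbove {a | ∃ x, p x = 1 ∧ a = p (B x)} := by
  obtain ⟨K, hK, hKp⟩ := p.exists_le_mul_norm
  obtain ⟨L, hL, hLp⟩ := hp.exists_norm_le_mul
  refine ⟨K * (‖B‖ * L), ?_⟩
  rintro _ ⟨x, hx, rfl⟩
  calc p (B x) ≤ K * ‖B x‖ := hKp _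
    _ ≤ K * (‖B‖ * ‖x‖) := by gcongr; exact B.le_opNorm x
    _ ≤ K * (‖B‖ * L) := by gcongr; simpa [hx] using hLp x

theorem le_inducedNorm_mul (hp : IsNorm p)
    (B : EuclideanSpace ℝ (Fin n) →L[ℝ] EuclideanSpace ℝ (Fin n))
    (x : EuclideanSpace ℝ (Fin n)) : p (B x) ≤ inducedNorm p B * p x := by
  by_cases hx : x = 0
  · simp [hx]
  have hpos : 0 < p x := lt_of_le_of_ne (apply_nonneg p x) fun h0 => hx (hp x h0.symm)
  have h1 : p (B ((p x)⁻¹ • x)) ≤ inducedNorm p B := by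
    refine le_csSup (bddAbove_inducedNorm hp B) ⟨_, ?_, rfl⟩
    rw [map_smul_eq_mul, norm_inv, Real.norm_of_nonneg hpos.le, inv_mul_cancel₀ hpos.ne']
  rw [map_smul, map_smul_eq_mul, norm_inv, Real.norm_of_nonneg hpos.le, inv_mul_eq_div,
    div_le_iff₀ hpos] at h1
  exact h1

theorem IsNorm.exists_eq_one [Nonempty (Fin n)] (hp : IsNorm p) : ∃ x, p x = 1 := by
  obtain ⟨x, hx⟩ := exists_ne (0 : EuclideanSpace ℝ (Fin n))
  have hpos : 0 < p x := lt_of_le_of_ne (apply_nonneg p x) fun h0 => hx (hp x h0.symm)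
  refine ⟨(p x)⁻¹ • x, ?_⟩
  rw [map_smul_eq_mul, norm_inv, Real.norm_of_nonneg hpos.le, inv_mul_cancel₀ hpos.ne']

theorem convexOn_inducedNorm_id_add_smul [Nonempty (Fin n)] (hp : IsNorm p)
    (A : EuclideanSpace ℝ (Fin n) →L[ℝ] EuclideanSpace ℝ (Fin n)) :
    ConvexOn ℝ univ fun h : ℝ =>
      inducedNorm p (ContinuousLinearMap.id ℝ (EuclideanSpace ℝ (Fin n)) + h • A) := by
  refine ⟨convex_univ, fun s _ t _ a b ha hb hab => ?_⟩
  obtain ⟨x₀, hx₀⟩ := hp.exists_eq_one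
  refine csSup_le ⟨_, x₀, hx₀, rfl⟩ ?_
  rintro _ ⟨x, hx, rfl⟩
  have e : (ContinuousLinearMap.id ℝ (EuclideanSpace ℝ (Fin n)) + (a • s + b • t) • A) x =
      a • (ContinuousLinearMap.id ℝ (EuclideanSpace ℝ (Fin n)) + s • A) x +
      b • (ContinuousLinearMap.id ℝ (EuclideanSpace ℝ (Fin n)) + t • A) x := by
    simp only [add_apply, smul_apply,
      ContinuousLinearMap.id_apply, smul_eq_mul]
    nth_rewrite 1 [← one_smul ℝ x, ← hab]
    module
  have hs := le_inducedNorm_mul hp (ContinuousLinearMap.id ℝ _ + s • A) x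
  have ht := le_inducedNorm_mul hp (ContinuousLinearMap.id ℝ _ + t • A) x
  rw [hx, mul_one] at hs ht
  rw [e]
  refine (map_add_le_add p _ _).trans ?_
  rw [map_smul_eq_mul, map_smul_eq_mul, Real.norm_of_nonneg ha, Real.norm_of_nonneg hb]
  simp only [smul_eq_mul]
  gcongr

theorem inducedNorm_id [Nonempty (Fin n)] (hp : IsNorm p) :
    inducedNorm p (ContinuousLinearMap.id ℝ (EuclideanSpace ℝ (Fin n))) = 1 := by
  obtain ⟨x₀, hx₀⟩ := hp.exists_eq_one
  have : {a | ∃ x, p x = 1 ∧ a = p (ContinuousLinearMap.id ℝ (EuclideanSpace ℝ (Fin n)) x)}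
      = {1} := by
    ext a
    constructor
    · rintro ⟨x, hx, rfl⟩
      simpa using hx
    · rintro rfl
      exact ⟨x₀, hx₀, by simpa using hx₀.symm⟩
  rw [inducedNorm, this, csSup_singleton]

/-- The quotient is the slope at `0` of a convex function of `h`, and convex functions have right
derivatives. Hence the `limUnder` in `matrixMeasure` is a genuine limit. -/
theorem tendsto_matrixMeasure [Nonempty (Fin n)] (hp : IsNorm p)
    (A : EuclideanSpace ℝ (Fin n) →L[ℝ] EuclideanSpace ℝ (Fin n)) :
    Tendsto (fun h : ℝ =>
      (inducedNorm p (ContinuousLinearMap.id ℝ (EuclideanSpace ℝ (Fin n)) + h • A) - 1) / h)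
      (𝓝[>] 0) (𝓝 (matrixMeasure p A)) := by
  have h1 := (convexOn_inducedNorm_id_add_smul hp A).hasDerivWithinAt_rightDeriv_of_mem_interior
    (x := 0) (by simp)
  rw [hasDerivWithinAt_iff_tendsto_slope' self_notMem_Ioi] at h1
  refine tendsto_nhds_limUnder ⟨_, h1.congr fun h => ?_⟩
  have e : ContinuousLinearMap.id ℝ (EuclideanSpace ℝ (Fin n)) + (0 : ℝ) • A =
      ContinuousLinearMap.id ℝ (EuclideanSpace ℝ (Fin n)) := by
    ext x i
    simp
  rw [slope_def_field, e, inducedNorm_id hp, sub_zero]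

/-- The upper right derivative of `p (u ·)` is controlled by the matrix measure of the linear part
of the derivative of `u`. -/
theorem eventually_slope_comp_lt [Nonempty (Fin n)] (hp : IsNorm p)
    {A : EuclideanSpace ℝ (Fin n) →L[ℝ] EuclideanSpace ℝ (Fin n)}
    {u : ℝ → EuclideanSpace ℝ (Fin n)} {u' : EuclideanSpace ℝ (Fin n)} {t R : ℝ}
    (hu : HasDerivWithinAt u u' (Ici t) t)
    (hR : matrixMeasure p A * p (u t) + p (u' - A (u t)) < R) :
    ∀ᶠ s in 𝓝[>] t, slope (fun s => p (u s)) t s < R := by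
  have h1 : Tendsto (fun s : ℝ =>
      (inducedNorm p (ContinuousLinearMap.id ℝ (EuclideanSpace ℝ (Fin n)) + (s - t) • A) - 1)
        / (s - t)) (𝓝[>] t) (𝓝 (matrixMeasure p A)) := by
    refine (tendsto_matrixMeasure hp A).comp (tendsto_nhdsWithin_iff.2 ⟨?_, ?_⟩)
    · have : Tendsto (fun s : ℝ => s - t) (𝓝 t) (𝓝 (t - t)) := (continuous_sub_right t).tendsto t
      rw [sub_self] at this
      exact this.mono_left nhdsWithin_le_nhds
    · filter_upwards [self_mem_nhdsWithin] with s hs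
      exact sub_pos.2 (mem_Ioi.1 hs)
  have h2 : Tendsto (fun s => p (slope u t s - u')) (𝓝[>] t) (𝓝 0) := by
    have h3 := (hasDerivWithinAt_iff_tendsto_slope' self_notMem_Ioi).1 (hu.mono Ioi_subset_Ici_self)
    have h4 := (p.continuous_euclideanSpace.tendsto (u' - u')).comp (h3.sub_const u')
    rwa [sub_self, map_zero] at h4
  have h3 := ((h1.mul_const (p (u t))).add_const (p (u' - A (u t)))).add h2
  rw [add_zero] at h3
  filter_upwards [h3.eventually_lt_const hR, self_mem_nhdsWithin] with s hs hts
  have hpos : 0 < s - t := sub_pos.2 hts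
  refine lt_of_le_of_lt ?_ hs
  -- Euler step with the linear part `A`, plus the defect of `A` and the error of the difference
  -- quotient.
  have e : u s = (ContinuousLinearMap.id ℝ (EuclideanSpace ℝ (Fin n)) + (s - t) • A) (u t)
      + ((s - t) • (u' - A (u t)) + (s - t) • (slope u t s - u')) := by
    have : (s - t) • slope u t s = u s - u t := by
      rw [slope_def_module, smul_inv_smul₀ hpos.ne']
    simp only [add_apply, smul_apply,
      ContinuousLinearMap.id_apply, smul_sub, this]
    abel
  have h4 : p (u s) ≤ inducedNorm p (ContinuousLinearMap.id ℝ _ + (s - t) • A) * p (u t)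
      + ((s - t) * p (u' - A (u t)) + (s - t) * p (slope u t s - u')) := by
    nth_rewrite 1 [e]
    refine (map_add_le_add p _ _).trans (add_le_add (le_inducedNorm_mul hp _ _)
      ((map_add_le_add p _ _).trans ?_))
    rw [map_smul_eq_mul, map_smul_eq_mul, Real.norm_of_nonneg hpos.le]
  rw [slope_def_field, div_le_iff₀ hpos]
  have e2 : ((inducedNorm p (ContinuousLinearMap.id ℝ _ + (s - t) • A) - 1) / (s - t) * p (u t)
      + p (u' - A (u t)) + p (slope u t s - u')) * (s - t) =
      (inducedNorm p (ContinuousLinearMap.id ℝ _ + (s - t) • A) - 1) * p (u t)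
      + ((s - t) * p (u' - A (u t)) + (s - t) * p (slope u t s - u')) := by
    field_simp
    ring
  rw [e2]
  linarith

end InducedNorm

/-! ### Separation of nearby solutions within one mode -/

section LocalEstimate

/-- Strict differentiability and continuity of the derivative at a point make the linearization
error uniform near it; compactness then gives one `δ`. The point `y` need not lie in `K`. -/
theorem IsCompact.exists_forall_norm_sub_fderiv_le {E F : Type*} [NormedAddCommGroup E]
    [NormedSpace ℝ E] [NormedAddCommGroup F] [NormedSpace ℝ F] {g : E → F} {K : Set E}
    (hK : IsCompact K) (hg : ∀ x ∈ K, ContDiffAt ℝ 1 g x) {η : ℝ} (hη : 0 < η) :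
    ∃ δ > 0, ∀ x ∈ K, ∀ y, ‖y - x‖ < δ →
      ContinuousAt g y ∧ ‖g y - g x - fderiv ℝ g x (y - x)‖ ≤ η * ‖y - x‖ := by
  refine hK.induction_on (p := fun S => ∃ δ > 0, ∀ x ∈ S, ∀ y, ‖y - x‖ < δ →
      ContinuousAt g y ∧ ‖g y - g x - fderiv ℝ g x (y - x)‖ ≤ η * ‖y - x‖)
    ⟨1, one_pos, by simp⟩ ?_ ?_ ?_
  · rintro S T hST ⟨δ, hδ, h⟩
    exact ⟨δ, hδ, fun x hx => h x (hST hx)⟩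
  · rintro S T ⟨δ, hδ, h⟩ ⟨δ', hδ', h'⟩
    refine ⟨min δ δ', lt_min hδ hδ', fun x hx y hy => ?_⟩
    rcases hx with hx | hx
    · exact h x hx y (hy.trans_le (min_le_left _ _))
    · exact h' x hx y (hy.trans_le (min_le_right _ _))
  · intro x₀ hx₀
    have hc := hg x₀ hx₀
    have h1 : ∀ᶠ q in 𝓝 (x₀, x₀),
        ‖g q.1 - g q.2 - fderiv ℝ g x₀ (q.1 - q.2)‖ ≤ η / 2 * ‖q.1 - q.2‖ :=
      (hc.hasStrictFDerivAt one_ne_zero).isLittleO.def (half_pos hη)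
    have h2 : ∀ᶠ x in 𝓝 x₀, ‖fderiv ℝ g x - fderiv ℝ g x₀‖ < η / 2 := by
      have : ContinuousAt (fderiv ℝ g) x₀ :=
        (hc.fderiv_right (m := 0) (by norm_num)).continuousAt
      filter_upwards [Metric.continuousAt_iff'.1 this (η / 2) (half_pos hη)] with x hx
      rwa [← dist_eq_norm]
    have h3 : ∀ᶠ y in 𝓝 x₀, ContinuousAt g y :=
      (hc.eventually (by simp)).mono fun y hy => hy.continuousAt
    rw [nhds_prod_eq] at h1
    obtain ⟨r, hr, hball⟩ := Metric.mem_nhds_iff.1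
      (show {q : E × E | ‖g q.1 - g q.2 - fderiv ℝ g x₀ (q.1 - q.2)‖ ≤ η / 2 * ‖q.1 - q.2‖ ∧
        ContinuousAt g q.1 ∧ ‖fderiv ℝ g q.2 - fderiv ℝ g x₀‖ < η / 2} ∈ 𝓝 (x₀, x₀) by
        rw [nhds_prod_eq]
        exact h1.and ((h3.prod_inl _).and (h2.prod_inr _)))
    refine ⟨Metric.ball x₀ (r / 2), mem_nhdsWithin_of_mem_nhds (Metric.ball_mem_nhds _ (half_pos hr)),
      r / 2, half_pos hr, fun x hx y hy => ?_⟩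
    have hx' : dist x x₀ < r / 2 := hx
    have hy' : dist y x₀ < r := by
      calc dist y x₀ ≤ dist y x + dist x x₀ := dist_triangle _ _ _
        _ < r / 2 + r / 2 := add_lt_add (by rwa [dist_eq_norm]) hx'
        _ = r := add_halves r
    obtain ⟨k1, k2, k3⟩ := @hball (y, x) (by
      rw [Metric.mem_ball, Prod.dist_eq]
      exact max_lt hy' (by simp only; linarith))
    refine ⟨k2, ?_⟩
    simp only at k1 k3
    have e : g y - g x - fderiv ℝ g x (y - x) = (g y - g x - fderiv ℝ g x₀ (y - x))
        - (fderiv ℝ g x - fderiv ℝ g x₀) (y - x) := by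
      rw [sub_apply]
      abel
    rw [e]
    calc _ ≤ ‖g y - g x - fderiv ℝ g x₀ (y - x)‖ + ‖(fderiv ℝ g x - fderiv ℝ g x₀) (y - x)‖ :=
          norm_sub_le _ _
      _ ≤ η / 2 * ‖y - x‖ + η / 2 * ‖y - x‖ := by
          gcongr
          exact ((fderiv ℝ g x - fderiv ℝ g x₀).le_opNorm _).trans (by gcongr)
      _ = η * ‖y - x‖ := by ring

variable {n : ℕ} {p : Seminorm ℝ (EuclideanSpace ℝ (Fin n))}

/-- Near a trajectory `z` of an autonomous field in `C`, other trajectories depend on their initial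
value with a Lipschitz constant arbitrarily close to the one given by the matrix measure. -/
theorem exists_forall_seminorm_sub_le [Nonempty (Fin n)] (hp : IsNorm p)
    {C : Set (EuclideanSpace ℝ (Fin n))}
    {g : EuclideanSpace ℝ (Fin n) → EuclideanSpace ℝ (Fin n)} {α : ℝ}
    (hg : ∀ x ∈ C, ContDiffAt ℝ 1 g x) (hα : ∀ x ∈ C, matrixMeasure p (fderiv ℝ g x) ≤ α)
    {a b : ℝ} {z : ℝ → EuclideanSpace ℝ (Fin n)} (hz : ContinuousOn z (Icc a b))
    (hzC : ∀ t ∈ Icc a b, z t ∈ C)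
    (hz' : ∀ t ∈ Ico a b, HasDerivWithinAt z (g (z t)) (Ici t) t) {ε : ℝ} (hε : 0 < ε) :
    ∃ δ > 0, ∀ y : ℝ → EuclideanSpace ℝ (Fin n), ContinuousOn y (Icc a b) →
      (∀ t ∈ Ico a b, ContinuousAt g (y t) → HasDerivWithinAt y (g (y t)) (Ici t) t) →
      ∀ d, 0 < d → d < δ → p (y a - z a) ≤ d →
      ∀ t ∈ Icc a b, p (y t - z t) ≤ Real.exp ((α + ε) * (t - a)) * d := by
  obtain ⟨A, hA, hpA⟩ := p.exists_le_mul_norm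
  obtain ⟨B, hB, hpB⟩ := hp.exists_norm_le_mul
  -- With this `η`, the linearization error measured in `p` is at most `ε / 2 * p (y t - z t)`. The
  -- other half of `ε` makes the comparison strict.
  obtain ⟨δ₀, hδ₀, htube⟩ := (isCompact_Icc.image_of_continuousOn hz).exists_forall_norm_sub_fderiv_le
    (g := g) (by rintro _ ⟨t, ht, rfl⟩; exact hg _ (hzC t ht))
    (η := ε / 2 / (A * B)) (by positivity)
  set δ₁ := δ₀ / B with hδ₁
  have hδ₁pos : 0 < δ₁ := by positivity
  set M := Real.exp (|α + ε| * (b - a)) with hM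
  have hMpos : 0 < M := Real.exp_pos _
  refine ⟨δ₁ / M, by positivity, fun y hy hy' d hd hdδ hya => ?_⟩
  have hbd : ∀ t ∈ Icc a b, Real.exp ((α + ε) * (t - a)) * d < δ₁ := by
    intro t ht
    have h1 : Real.exp ((α + ε) * (t - a)) ≤ M := by
      refine Real.exp_le_exp.2 ?_
      calc (α + ε) * (t - a) ≤ |α + ε| * (t - a) :=
            mul_le_mul_of_nonneg_right (le_abs_self _) (sub_nonneg.2 ht.1)
        _ ≤ |α + ε| * (b - a) := by gcongr; exact ht.2
    calc Real.exp ((α + ε) * (t - a)) * d ≤ M * d := by gcongr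
      _ < δ₁ := by rwa [lt_div_iff₀ hMpos, mul_comm] at hdδ
  have hcont : ContinuousOn (fun t => p (y t - z t)) (Icc a b) :=
    p.continuous_euclideanSpace.comp_continuousOn (hy.sub hz)
  -- Outside the tube around `z` nothing is known about `y`. The distance is therefore cut off at
  -- `δ₁`, where its right slopes are nonpositive; the comparison function stays below `δ₁`, so the
  -- cut-off is never felt.
  have key := image_le_of_liminf_slope_right_lt_deriv_boundary'
    (f := fun t => min (p (y t - z t)) δ₁)
    (f' := fun t => if p (y t - z t) < δ₁ then (α + ε / 2) * p (y t - z t) else 0)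
    (a := a) (b := b) (hcont.inf continuousOn_const)
    (B := fun t => Real.exp ((α + ε) * (t - a)) * d)
    (B' := fun t => Real.exp ((α + ε) * (t - a)) * (α + ε) * d) ?_ ?_ (by fun_prop) ?_ ?_
  · intro t ht
    have h1 := key ht
    have h2 := hbd t ht
    rcases min_le_iff.1 h1 with h | h
    · exact h
    · exact absurd h h2.not_ge
  · intro t ht r hr
    refine Eventually.frequently ?_
    have htI : t ∈ Icc a b := Ico_subset_Icc_self ht
    split_ifs at hr with hlt
    · have hsmall : ‖y t - z t‖ < δ₀ := by
        refine (hpB _).trans_lt ?_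
        rwa [hδ₁, lt_div_iff₀ hB, mul_comm] at hlt
      obtain ⟨hgc, hge⟩ := htube (z t) (mem_image_of_mem _ htI) (y t) hsmall
      have hder : HasDerivWithinAt (fun s => y s - z s) (g (y t) - g (z t)) (Ici t) t :=
        (hy' t ht hgc).sub (hz' t ht)
      have hpe : p (g (y t) - g (z t) - fderiv ℝ g (z t) (y t - z t))
          ≤ ε / 2 * p (y t - z t) := by
        calc _ ≤ A * ‖g (y t) - g (z t) - fderiv ℝ g (z t) (y t - z t)‖ := hpA _
          _ ≤ A * (ε / 2 / (A * B) * (B * p (y t - z t))) := by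
              gcongr
              exact hge.trans (by gcongr; exact hpB _)
          _ = ε / 2 * p (y t - z t) := by field_simp
      have hslope := eventually_slope_comp_lt hp (A := fderiv ℝ g (z t)) hder (R := r) (by
        have := mul_le_mul_of_nonneg_right (hα _ (hzC t htI)) (apply_nonneg p (y t - z t))
        nlinarith)
      have hlt' : ∀ᶠ s in 𝓝[>] t, p (y s - z s) < δ₁ := by
        have h1 : ContinuousWithinAt (fun s => p (y s - z s)) (Ioi t) t :=
          p.continuous_euclideanSpace.continuousAt.comp_continuousWithinAt
            (hder.continuousWithinAt.mono Ioi_subset_Ici_self)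
        exact h1.eventually_lt_const hlt
      filter_upwards [hslope, hlt'] with s hs1 hs2
      rw [slope_def_field] at hs1 ⊢
      rwa [min_eq_left hs2.le, min_eq_left hlt.le]
    · filter_upwards [self_mem_nhdsWithin] with s hs
      rw [slope_def_field, min_eq_right (not_lt.1 hlt)]
      refine lt_of_le_of_lt ?_ hr
      exact div_nonpos_of_nonpos_of_nonneg (sub_nonpos.2 (min_le_right _ _))
        (sub_nonneg.2 (mem_Ioi.1 hs).le)
  · simpa using Or.inl hya
  · intro t _
    have h1 : HasDerivAt (fun t : ℝ => (α + ε) * (t - a)) (α + ε) t := by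
      simpa using ((hasDerivAt_id t).sub_const a).const_mul (α + ε)
    exact (h1.exp.mul_const d).hasDerivWithinAt
  · intro t ht heq
    have h2 := hbd t (Ico_subset_Icc_self ht)
    have hBpos : 0 < Real.exp ((α + ε) * (t - a)) * d := by positivity
    have hlt : p (y t - z t) < δ₁ := by
      by_contra h
      rw [min_eq_right (not_lt.1 h)] at heq
      linarith
    rw [if_pos hlt]
    rw [min_eq_left hlt.le] at heq
    rw [heq]
    -- Here `d > 0` matters: at a contact point the common value is positive, so rate `α + ε / 2` is
    -- strictly below `α + ε`.
    nlinarith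

end LocalEstimate

/-! ### Accumulating the exponent over the modes -/

section SwitchedSystem

/-- The exponent collected on `[0, t]` if mode `i` is the last one to be active. -/
noncomputable def modeExponent (τ α β : ℕ → ℝ) (i : ℕ) (t : ℝ) : ℝ :=
  (∑ l ∈ Finset.range i, (α l * (τ (l + 1) - τ l) + Real.log (β l))) + α i * (t - τ i)

theorem modeExponent_sub (τ α β : ℕ → ℝ) (i : ℕ) (s t : ℝ) :
    modeExponent τ α β i t - modeExponent τ α β i s = α i * (t - s) := by
  simp only [modeExponent]
  ring

theorem modeExponent_succ (τ α β : ℕ → ℝ) (i : ℕ) (t : ℝ) :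
    modeExponent τ α β (i + 1) t = modeExponent τ α β i (τ (i + 1)) + Real.log (β i)
      + α (i + 1) * (t - τ (i + 1)) := by
  simp only [modeExponent, Finset.sum_range_succ]
  ring

variable {n : ℕ} {f : EuclideanSpace ℝ (Fin n) → ℝ → EuclideanSpace ℝ (Fin n)} {r : ℝ → ℝ}
  {C : Set (EuclideanSpace ℝ (Fin n))} {τ ξ : ℕ → ℝ}
  {N : ℝ → Seminorm ℝ (EuclideanSpace ℝ (Fin n))}

theorem IsStaircase.nonneg (hr : IsStaircase r τ ξ) (i : ℕ) : 0 ≤ τ i :=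
  hr.zero ▸ hr.strictMono.monotone (Nat.zero_le i)

theorem IsStaircase.contDiffAt (hr : IsStaircase r τ ξ) (hf : RegularField f r C) (i : ℕ)
    {x : EuclideanSpace ℝ (Fin n)} (hx : x ∈ C) : ContDiffAt ℝ 1 (fun y => f y (ξ i)) x := by
  have h := hf.contDiffAt x hx (τ i) (hr.nonneg i)
  rwa [hr.eq i (τ i) ⟨le_rfl, hr.strictMono i.lt_succ_self⟩] at h

/-- The signal is constant just to the right of `t`, even at a switching time, so the integrand is
right continuous there. -/
theorem IsSolution.hasDerivWithinAt (hr : IsStaircase r τ ξ) {t₀ t : ℝ}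
    {x : ℝ → EuclideanSpace ℝ (Fin n)} (hx : IsSolution f r t₀ x) (ht₀ : t₀ ≤ t) {i : ℕ}
    (ht : t ∈ Ico (τ i) (τ (i + 1))) (hc : ContinuousAt (fun v => f v (ξ i)) (x t)) :
    HasDerivWithinAt x (f (x t) (ξ i)) (Ici t) t := by
  have hri := hr.eq i t ht
  have hmeas : StronglyMeasurableAtFilter (fun s => f (x s) (r s)) (𝓝[>] t) := by
    refine ⟨Ioc t₀ (t + 1), ?_, (hx.2 (t + 1) (by linarith)).1.1.aestronglyMeasurable⟩
    filter_upwards [Ioc_mem_nhdsGT (lt_add_one t)] with s hs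
    exact ⟨ht₀.trans_lt hs.1, hs.2⟩
  have hxc : ContinuousWithinAt x (Ioi t) t :=
    (hx.1 t ht₀).mono fun s hs => ht₀.trans (le_of_lt hs)
  have hcont : ContinuousWithinAt (fun s => f (x s) (r s)) (Ioi t) t := by
    have h1 : ContinuousWithinAt (fun s => f (x s) (ξ i)) (Ioi t) t :=
      ContinuousAt.comp_continuousWithinAt (g := fun v => f v (ξ i)) hc hxc
    refine h1.congr_of_eventuallyEq ?_ (by rw [hri])
    filter_upwards [Ioo_mem_nhdsGT ht.2] with s hs
    rw [hr.eq i s ⟨ht.1.trans hs.1.le, hs.2⟩]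
  have h1 := intervalIntegral.integral_hasDerivWithinAt_right (s := Ici t) (hx.2 t ht₀).1 hmeas hcont
  rw [hri] at h1
  exact (h1.const_add (x t₀)).congr (fun s hs => (hx.2 s (ht₀.trans hs)).2) (hx.2 t ht₀).2

theorem IsStaircase.exists_forall_solution_sub_le [Nonempty (Fin n)] (hr : IsStaircase r τ ξ)
    (hf : RegularField f r C) {i : ℕ} (hN : IsNorm (N (ξ i))) {α : ℝ}
    (hα : ∀ x ∈ C, matrixMeasure (N (ξ i)) (fderiv ℝ (fun y => f y (ξ i)) x) ≤ α)
    {t₀ a b : ℝ} (ht₀ : t₀ ≤ a) (ha : τ i ≤ a) (hb : b ≤ τ (i + 1))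
    {z : ℝ → EuclideanSpace ℝ (Fin n)} (hz : IsSolution f r t₀ z) (hzC : ∀ t, t₀ ≤ t → z t ∈ C)
    {ε : ℝ} (hε : 0 < ε) :
    ∃ δ > 0, ∀ y, IsSolution f r t₀ y → ∀ d, 0 < d → d < δ → N (ξ i) (y a - z a) ≤ d →
      ∀ t ∈ Icc a b, N (ξ i) (y t - z t) ≤ Real.exp ((α + ε) * (t - a)) * d := by
  have hsub : ∀ t ∈ Icc a b, t₀ ≤ t := fun t ht => ht₀.trans ht.1
  have hico : ∀ t ∈ Ico a b, t ∈ Ico (τ i) (τ (i + 1)) :=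
    fun t ht => ⟨ha.trans ht.1, ht.2.trans_le hb⟩
  obtain ⟨δ, hδ, h⟩ := exists_forall_seminorm_sub_le hN (g := fun y => f y (ξ i))
    (fun x hx => hr.contDiffAt hf i hx) hα (hz.1.mono hsub)
    (fun t ht => hzC t (hsub t ht))
    (fun t ht => hz.hasDerivWithinAt hr (ht₀.trans ht.1) (hico t ht)
      (hr.contDiffAt hf i (hzC t (ht₀.trans ht.1))).continuousAt) hε
  exact ⟨δ, hδ, fun y hy => h y (hy.1.mono hsub)
    (fun t ht hc => hy.hasDerivWithinAt hr (ht₀.trans ht.1) (hico t ht) hc)⟩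

theorem IsStaircase.exists_forall_solution_sub_le_modeExponent [Nonempty (Fin n)]
    (hr : IsStaircase r τ ξ) (hf : RegularField f r C) (hN : ∀ i, IsNorm (N (ξ i)))
    {α β : ℕ → ℝ} (hβ : ∀ j, 0 < β j)
    (hα : ∀ j, ∀ x ∈ C, matrixMeasure (N (ξ j)) (fderiv ℝ (fun y => f y (ξ j)) x) ≤ α j)
    (hswitch : ∀ j x, N (ξ (j + 1)) x ≤ β j * N (ξ j) x)
    {t₀ : ℝ} {k : ℕ} (hk : t₀ ∈ Ico (τ k) (τ (k + 1))) {z : ℝ → EuclideanSpace ℝ (Fin n)}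
    (hz : IsSolution f r t₀ z) (hzC : ∀ t, t₀ ≤ t → z t ∈ C) {ε : ℝ} (hε : 0 < ε) {m : ℕ}
    (hm : k ≤ m) :
    ∃ δ > 0, ∀ y, IsSolution f r t₀ y → ∀ d, 0 < d → d < δ → N (ξ k) (y t₀ - z t₀) ≤ d →
      ∀ t, t₀ ≤ t → τ m ≤ t → t ≤ τ (m + 1) → N (ξ m) (y t - z t) ≤
        Real.exp (modeExponent τ α β m t - modeExponent τ α β k t₀ + ε * (t - t₀)) * d := by
  induction m, hm using Nat.le_induction with
  | base =>
    obtain ⟨δ, hδ, h⟩ := hr.exists_forall_solution_sub_le hf (hN k) (hα k) le_rfl hk.1 le_rfl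
      hz hzC hε
    refine ⟨δ, hδ, fun y hy d hd hdδ hyd t ht _ ht' => ?_⟩
    convert h y hy d hd hdδ hyd t ⟨ht, ht'⟩ using 3
    rw [modeExponent_sub]
    ring
  | succ m hm ih =>
    obtain ⟨δ, hδ, h⟩ := ih
    have hkm : t₀ ≤ τ (m + 1) :=
      hk.2.le.trans (hr.strictMono.monotone (Nat.succ_le_succ hm))
    obtain ⟨δ', hδ', h'⟩ := hr.exists_forall_solution_sub_le hf (hN (m + 1)) (hα (m + 1))
      hkm le_rfl le_rfl hz hzC hε
    set G := β m * Real.exp (modeExponent τ α β m (τ (m + 1)) - modeExponent τ α β k t₀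
      + ε * (τ (m + 1) - t₀)) with hG
    have hGpos : 0 < G := mul_pos (hβ m) (Real.exp_pos _)
    -- `G` bounds the growth up to and across the switch, so `δ' / G` keeps the distance at the
    -- start of mode `m + 1` below `δ'`.
    refine ⟨min δ (δ' / G), by positivity, fun y hy d hd hdδ hyd t ht ht1 ht2 => ?_⟩
    have h1 := h y hy d hd (hdδ.trans_le (min_le_left _ _)) hyd (τ (m + 1)) hkm
      (hr.strictMono (Nat.lt_succ_self _)).le le_rfl
    have h2 : N (ξ (m + 1)) (y (τ (m + 1)) - z (τ (m + 1))) ≤ G * d := by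
      refine (hswitch m _).trans ?_
      rw [hG, mul_assoc]
      exact mul_le_mul_of_nonneg_left h1 (hβ m).le
    have h3 : G * d < δ' := by
      have := hdδ.trans_le (min_le_right _ _)
      rwa [lt_div_iff₀ hGpos, mul_comm] at this
    refine (h' y hy (G * d) (by positivity) h3 h2 t ⟨ht1, ht2⟩).trans_eq ?_
    rw [hG, ← mul_assoc]
    congr 1
    nth_rewrite 1 [← Real.exp_log (hβ m)]
    rw [← Real.exp_add, ← Real.exp_add, modeExponent_succ]
    congr 1
    ring

end SwitchedSystem

/-! ### A mean value inequality along curves -/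

section Curves

variable {n : ℕ}

/-- The map `φ` need not be differentiable: the local bound makes `p (φ s - φ 0)` continuous with
upper right derivative at most `M`. -/
theorem Seminorm.sub_le_of_eventually_le (p : Seminorm ℝ (EuclideanSpace ℝ (Fin n)))
    {φ : ℝ → EuclideanSpace ℝ (Fin n)} {M : ℝ}
    (h : ∀ s ∈ Icc (0 : ℝ) 1, ∀ᶠ s' in 𝓝[Icc 0 1] s, p (φ s' - φ s) ≤ M * |s' - s|) :
    p (φ 1 - φ 0) ≤ M := by
  have hdiff : ∀ s s', |p (φ s' - φ 0) - p (φ s - φ 0)| ≤ p (φ s' - φ s) := by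
    intro s s'
    have := abs_sub_map_le_sub p (φ s' - φ 0) (φ s - φ 0)
    rwa [sub_sub_sub_cancel_right] at this
  have hcont : ContinuousOn (fun s => p (φ s - φ 0)) (Icc 0 1) := by
    intro s hs
    rw [ContinuousWithinAt, tendsto_iff_dist_tendsto_zero]
    have h1 : Tendsto (fun s' => M * |s' - s|) (𝓝[Icc 0 1] s) (𝓝 0) := by
      have : Tendsto (fun s' => M * |s' - s|) (𝓝 s) (𝓝 (M * |s - s|)) :=
        (by fun_prop : Continuous fun s' => M * |s' - s|).tendsto s
      rw [sub_self, abs_zero, mul_zero] at this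
      exact this.mono_left nhdsWithin_le_nhds
    refine squeeze_zero' (Eventually.of_forall fun _ => dist_nonneg) ?_ h1
    filter_upwards [h s hs] with s' hs'
    rw [Real.dist_eq]
    exact (hdiff s s').trans hs'
  have key := image_le_of_liminf_slope_right_le_deriv_boundary (a := 0) (b := 1) hcont
    (B := fun s => M * s) (B' := fun _ => M) (by simp) (by fun_prop)
    (fun s _ => by simpa using ((hasDerivAt_id s).const_mul M).hasDerivWithinAt) ?_
    (right_mem_Icc.2 zero_le_one)
  · simpa using key
  · intro s hs R hR
    refine Eventually.frequently ?_
    have h1 := h s (Ico_subset_Icc_self hs)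
    have h2 : 𝓝[>] s ≤ 𝓝[Icc 0 1] s :=
      le_inf nhdsWithin_le_nhds (le_principal_iff.2 (mem_of_superset (Ioo_mem_nhdsGT hs.2)
        fun u hu => ⟨hs.1.trans hu.1.le, hu.2.le⟩))
    filter_upwards [h2 h1, self_mem_nhdsWithin] with s' hs' hss'
    have hpos : 0 < s' - s := sub_pos.2 hss'
    rw [slope_def_field, div_lt_iff₀ hpos]
    calc _ ≤ p (φ s' - φ s) := (le_abs_self _).trans (hdiff s s')
      _ ≤ M * |s' - s| := hs'
      _ = M * (s' - s) := by rw [abs_of_pos hpos]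
      _ < R * (s' - s) := by gcongr

theorem Seminorm.eventually_sub_le_of_hasDerivWithinAt
    (p : Seminorm ℝ (EuclideanSpace ℝ (Fin n))) {γ : ℝ → EuclideanSpace ℝ (Fin n)}
    {γ' : EuclideanSpace ℝ (Fin n)} {S : Set ℝ} {s L : ℝ} (hγ : HasDerivWithinAt γ γ' S s)
    (hL : p γ' < L) : ∀ᶠ s' in 𝓝[S] s, p (γ s' - γ s) ≤ L * |s' - s| := by
  obtain ⟨A, hA, hpA⟩ := p.exists_le_mul_norm
  have h1 := (hasDerivWithinAt_iff_isLittleO.1 hγ).def (c := (L - p γ') / A)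
    (div_pos (sub_pos.2 hL) hA)
  filter_upwards [h1] with s' hs'
  calc p (γ s' - γ s) = p ((γ s' - γ s - (s' - s) • γ') + (s' - s) • γ') := by rw [sub_add_cancel]
    _ ≤ p (γ s' - γ s - (s' - s) • γ') + p ((s' - s) • γ') := map_add_le_add p _ _
    _ ≤ A * ((L - p γ') / A * |s' - s|) + |s' - s| * p γ' := by
        rw [map_smul_eq_mul, Real.norm_eq_abs]
        gcongr
        exact (hpA _).trans (by gcongr; exact hs')
    _ = L * |s' - s| := by
        field_simp
        ring

end Curves

/-! ### From nearby solutions to arbitrary pairs -/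

section SwitchedSystem

variable {n : ℕ} {f : EuclideanSpace ℝ (Fin n) → ℝ → EuclideanSpace ℝ (Fin n)} {r : ℝ → ℝ}
  {C : Set (EuclideanSpace ℝ (Fin n))} {τ ξ : ℕ → ℝ}
  {N : ℝ → Seminorm ℝ (EuclideanSpace ℝ (Fin n))}

/-- Two solutions from `C` diverge at most at the rate given by the accumulated exponents. -/
theorem IsStaircase.seminorm_solution_sub_le [Nonempty (Fin n)]
    (hr : IsStaircase r τ ξ) (hf : RegularField f r C) (hN : ∀ i, IsNorm (N (ξ i)))
    {D : ℝ} (hD : 0 < D) (hequiv : ∀ i j x, N (ξ i) x ≤ D * N (ξ j) x)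
    {κ : ℝ} (hreach : IsReachable (N (ξ 0)) κ C) (hinv : ForwardInvariant f r C)
    {α β : ℕ → ℝ} (hβ : ∀ j, 0 < β j)
    (hα : ∀ j, ∀ x ∈ C, matrixMeasure (N (ξ j)) (fderiv ℝ (fun y => f y (ξ j)) x) ≤ α j)
    (hswitch : ∀ j x, N (ξ (j + 1)) x ≤ β j * N (ξ j) x)
    {t₀ t : ℝ} {k m : ℕ} (hk : t₀ ∈ Ico (τ k) (τ (k + 1))) (ht : t₀ ≤ t) (hkm : k ≤ m)
    (hm : t ∈ Icc (τ m) (τ (m + 1))) {x y : ℝ → EuclideanSpace ℝ (Fin n)}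
    (hx : IsSolution f r t₀ x) (hy : IsSolution f r t₀ y) (hxC : x t₀ ∈ C) (hyC : y t₀ ∈ C) :
    N (ξ 0) (x t - y t) ≤ D * D * κ *
      Real.exp (modeExponent τ α β m t - modeExponent τ α β k t₀) * N (ξ 0) (x t₀ - y t₀) := by
  obtain ⟨γ, hγ, hγC, hγ0, hγ1, hγ'⟩ := hreach _ hxC _ hyC
  set L := κ * N (ξ 0) (x t₀ - y t₀) with hL
  set F := modeExponent τ α β m t - modeExponent τ α β k t₀ with hF
  suffices H : ∀ ε > 0, N (ξ 0) (x t - y t) ≤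
      D * Real.exp (F + ε * (t - t₀)) * D * (L + ε) by
    have h1 : Tendsto (fun ε => D * Real.exp (F + ε * (t - t₀)) * D * (L + ε)) (𝓝[>] 0)
        (𝓝 (D * Real.exp (F + 0 * (t - t₀)) * D * (L + 0))) :=
      ((by fun_prop : Continuous fun ε => D * Real.exp (F + ε * (t - t₀)) * D * (L + ε)).tendsto
        0).mono_left nhdsWithin_le_nhds
    refine (ge_of_tendsto h1 (eventually_mem_nhdsWithin.mono H)).trans_eq ?_
    rw [hL, zero_mul, add_zero, add_zero]
    ring
  intro ε hε
  set K := Real.exp (F + ε * (t - t₀)) with hK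
  have hlocal : ∀ z, IsSolution f r t₀ z → (∀ t, t₀ ≤ t → z t ∈ C) → ∃ δ > 0, ∀ y,
      IsSolution f r t₀ y → N (ξ k) (y t₀ - z t₀) < δ →
      N (ξ m) (y t - z t) ≤ K * N (ξ k) (y t₀ - z t₀) := by
    intro z hz hzC
    obtain ⟨δ, hδ, h⟩ := hr.exists_forall_solution_sub_le_modeExponent hf hN hβ hα hswitch hk hz hzC
      hε hkm
    refine ⟨δ, hδ, fun y hy hyδ => ?_⟩
    -- The estimate asks for a bound `d > 0`, while the initial distance may vanish; so `d`
    -- decreases to that distance.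
    have h1 : Tendsto (fun d => K * d) (𝓝[>] N (ξ k) (y t₀ - z t₀))
        (𝓝 (K * N (ξ k) (y t₀ - z t₀))) :=
      ((continuous_const_mul K).tendsto _).mono_left nhdsWithin_le_nhds
    refine ge_of_tendsto h1 ?_
    filter_upwards [Ioo_mem_nhdsGT hyδ] with d hd
    exact h y hy d ((apply_nonneg _ _).trans_lt hd.1) hd.2 hd.1.le t ht hm.1 hm.2
  -- The local estimate yields uniqueness. Only `z` is required to stay in `C`, so the given `x` and
  -- `y` are identified with the solutions supplied by invariance.
  have huniq : ∀ z y, IsSolution f r t₀ z → (∀ t, t₀ ≤ t → z t ∈ C) → IsSolution f r t₀ y →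
      y t₀ = z t₀ → y t = z t := by
    intro z y hz hzC hy hyz
    obtain ⟨δ, hδ, h⟩ := hlocal z hz hzC
    have h1 := h y hy (by rwa [hyz, sub_self, map_zero])
    rw [hyz, sub_self, map_zero, mul_zero] at h1
    exact sub_eq_zero.1 (hN m _ (le_antisymm h1 (apply_nonneg _ _)))
  have hex : ∀ s : Icc (0 : ℝ) 1, ∃ z, IsSolution f r t₀ z ∧ z t₀ = γ s ∧
      ∀ t, t₀ ≤ t → z t ∈ C :=
    fun s => hinv t₀ ((hr.nonneg k).trans hk.1) _ (hγC s.2)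
  choose ψ hψ hψ0 hψC using hex
  -- The curve of initial values transported to time `t`; `projIcc` merely extends its parameter to
  -- `ℝ`.
  have key := (N (ξ 0)).sub_le_of_eventually_le (φ := fun s => ψ (projIcc 0 1 zero_le_one s) t)
    (M := D * K * D * (L + ε)) ?_
  · have e0 : x t = ψ (projIcc 0 1 zero_le_one 0) t := by
      refine huniq _ _ (hψ _) (hψC _) hx ?_
      rw [hψ0, projIcc_left, ← hγ0]
    have e1 : y t = ψ (projIcc 0 1 zero_le_one 1) t := by
      refine huniq _ _ (hψ _) (hψC _) hy ?_
      rw [hψ0, projIcc_right, ← hγ1]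
    rw [map_sub_rev, e0, e1]
    exact key
  · intro s hs
    obtain ⟨δ, hδ, h⟩ := hlocal _ (hψ ⟨s, hs⟩) (hψC _)
    have hder := ((hγ.differentiableOn one_ne_zero) s hs).hasDerivWithinAt
    have h1 := (N (ξ 0)).eventually_sub_le_of_hasDerivWithinAt hder
      (lt_of_le_of_lt (hγ' s hs) (lt_add_of_pos_right L hε))
    have h2 : ∀ᶠ s' in 𝓝[Icc 0 1] s, N (ξ k) (γ s' - γ s) < δ := by
      have hc : ContinuousWithinAt (fun s' => N (ξ k) (γ s' - γ s)) (Icc 0 1) s :=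
        (N (ξ k)).continuous_euclideanSpace.continuousAt.comp_continuousWithinAt
          (hder.continuousWithinAt.sub continuousWithinAt_const)
      exact hc.eventually_lt_const (by simpa using hδ)
    filter_upwards [h1, h2, self_mem_nhdsWithin] with s' hs1 hs2 hs'
    rw [projIcc_of_mem _ hs, projIcc_of_mem _ hs']
    have h3 := h _ (hψ ⟨s', hs'⟩) (by rwa [hψ0, hψ0])
    rw [hψ0, hψ0] at h3
    have hKpos : 0 < K := Real.exp_pos _
    calc N (ξ 0) (ψ ⟨s', hs'⟩ t - ψ ⟨s, hs⟩ t)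
        ≤ D * N (ξ m) (ψ ⟨s', hs'⟩ t - ψ ⟨s, hs⟩ t) := hequiv _ _ _
      _ ≤ D * (K * (D * ((L + ε) * |s' - s|))) := by
          gcongr
          refine h3.trans ?_
          gcongr
          refine (hequiv _ 0 _).trans ?_
          gcongr
      _ = D * K * D * (L + ε) * |s' - s| := by ring

end SwitchedSystem

/-! ### Bounds on the accumulated exponent -/

section Exponents

variable {r : ℝ → ℝ} {τ ξ : ℕ → ℝ}

theorem IsStaircase.exists_mem_Ico (hr : IsStaircase r τ ξ) {t : ℝ} (ht : 0 ≤ t) :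
    ∃ k, t ∈ Ico (τ k) (τ (k + 1)) := by
  have h : ∃ i, t < τ i := (hr.tendsto.eventually_gt_atTop t).exists
  have h0 : Nat.find h ≠ 0 := fun h0 => by
    have := Nat.find_spec h
    rw [h0, hr.zero] at this
    linarith
  obtain ⟨k, hk⟩ := Nat.exists_eq_succ_of_ne_zero h0
  exact ⟨k, not_lt.1 (Nat.find_min h (hk ▸ k.lt_succ_self)), by have := Nat.find_spec h; rwa [hk] at this⟩

/-- Half-open on the left because `switchCount` omits a switch at the final time: an interval ending
at a switching time ends in the earlier mode. -/
theorem IsStaircase.exists_mem_Ioc (hr : IsStaircase r τ ξ) {t : ℝ} (ht : 0 < t) :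
    ∃ m, t ∈ Ioc (τ m) (τ (m + 1)) := by
  have h : ∃ i, t ≤ τ i := (hr.tendsto.eventually_ge_atTop t).exists
  have h0 : Nat.find h ≠ 0 := fun h0 => by
    have := Nat.find_spec h
    rw [h0, hr.zero] at this
    linarith
  obtain ⟨k, hk⟩ := Nat.exists_eq_succ_of_ne_zero h0
  exact ⟨k, not_le.1 (Nat.find_min h (hk ▸ k.lt_succ_self)), by have := Nat.find_spec h; rwa [hk] at this⟩

theorem StrictMono.modeIndex_eq (hτ : StrictMono τ) {s : ℝ} {k : ℕ}
    (hk : s ∈ Ico (τ k) (τ (k + 1))) : modeIndex τ s = k := by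
  refine IsGreatest.csSup_eq ⟨hk.1, fun i hi => ?_⟩
  exact Nat.lt_succ_iff.1 (hτ.lt_iff_lt.1 (lt_of_le_of_lt hi hk.2))

theorem StrictMono.switchCount_eq (hτ : StrictMono τ) {s t : ℝ} {k m : ℕ}
    (hk : s ∈ Ico (τ k) (τ (k + 1))) (hm : t ∈ Ioc (τ m) (τ (m + 1))) :
    switchCount τ s t = m - k := by
  have : {i | s < τ i ∧ τ i < t} = ↑(Finset.Ioc k m) := by
    ext i
    simp only [mem_ofPred_eq, Finset.coe_Ioc, mem_Ioc]
    constructor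
    · rintro ⟨h1, h2⟩
      exact ⟨hτ.lt_iff_lt.1 (hk.1.trans_lt h1), Nat.lt_succ_iff.1 (hτ.lt_iff_lt.1 (h2.trans_le hm.2))⟩
    · rintro ⟨h1, h2⟩
      exact ⟨hk.2.trans_le (hτ.monotone h1), (hτ.monotone h2).trans_lt hm.1⟩
  rw [switchCount, this, Set.ncard_coe_finset, Nat.card_Ioc]

theorem StrictMono.mode_le (hτ : StrictMono τ) {s t : ℝ} {k m : ℕ}
    (hk : τ k ≤ s) (hm : t ≤ τ (m + 1)) (hst : s < t) : k ≤ m :=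
  Nat.lt_succ_iff.1 (hτ.lt_iff_lt.1 (hk.trans_lt (hst.trans_le hm)))

theorem StrictMono.totalExponent_eq (hτ : StrictMono τ) (α β : ℕ → ℝ) {s T : ℝ} (hT : 0 < T)
    {k m : ℕ} (hk : s ∈ Ico (τ k) (τ (k + 1))) (hm : s + T ∈ Ioc (τ m) (τ (m + 1))) :
    totalExponent τ α β s T = modeExponent τ α β m (s + T) - modeExponent τ α β k s := by
  have hkm : k ≤ m := hτ.mode_le hk.1 hm.2 (lt_add_of_pos_right s hT)
  simp only [totalExponent, modeExponent, hτ.modeIndex_eq hk, hτ.switchCount_eq hk hm,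
    Nat.add_sub_cancel' hkm, Finset.sum_Ico_eq_sub _ hkm]
  ring

/-- Only finitely many modes start by time `R`, and each has an affine exponent on a bounded
interval. -/
theorem IsStaircase.exists_modeExponent_le (hr : IsStaircase r τ ξ) (α β : ℕ → ℝ) (R : ℝ) :
    ∃ B, ∀ t ≤ R, ∀ m, τ m ≤ t → modeExponent τ α β m t ≤ B := by
  obtain ⟨M, hM⟩ := (hr.tendsto.eventually_gt_atTop R).exists
  refine ⟨∑ i ∈ Finset.range M, (|modeExponent τ α β i (τ i)| + |α i| * |R|), fun t ht m hm => ?_⟩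
  have hmM : m < M := hr.strictMono.lt_iff_lt.1 ((hm.trans ht).trans_lt hM)
  refine le_trans ?_ (Finset.single_le_sum
    (f := fun i => |modeExponent τ α β i (τ i)| + |α i| * |R|)
    (fun i _ => by positivity) (Finset.mem_range.2 hmM))
  have h1 := modeExponent_sub τ α β m (τ m) t
  have h2 : α m * (t - τ m) ≤ |α m| * |R| := by
    have h0 := hr.nonneg m
    calc α m * (t - τ m) ≤ |α m| * (t - τ m) :=
          mul_le_mul_of_nonneg_right (le_abs_self _) (sub_nonneg.2 hm)
      _ ≤ |α m| * |R| := by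
          gcongr
          linarith [le_abs_self R]
  linarith [le_abs_self (modeExponent τ α β m (τ m))]

theorem StrictMono.le_modeExponent_sub (hτ : StrictMono τ) {α β : ℕ → ℝ} {a : ℝ}
    (ha : ∀ i, a ≤ α i) {k m : ℕ} (hkm : k ≤ m) {s : ℝ} (hs : s ≤ τ (k + 1)) :
    ∀ t, s ≤ t → τ m ≤ t → a * (t - s) + ∑ i ∈ Finset.Ico k m, Real.log (β i) ≤
      modeExponent τ α β m t - modeExponent τ α β k s := by
  induction m, hkm using Nat.le_induction with
  | base =>
    intro t hst _
    rw [modeExponent_sub, Finset.Ico_self, Finset.sum_empty, add_zero]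
    exact mul_le_mul_of_nonneg_right (ha k) (sub_nonneg.2 hst)
  | succ m hm ih =>
    intro t hst hmt
    have h1 := ih (τ (m + 1)) (hs.trans (hτ.monotone (Nat.succ_le_succ hm)))
      (hτ m.lt_succ_self).le
    have h2 : a * (t - τ (m + 1)) ≤ α (m + 1) * (t - τ (m + 1)) :=
      mul_le_mul_of_nonneg_right (ha _) (sub_nonneg.2 hmt)
    rw [Finset.sum_Ico_succ_top hm, modeExponent_succ]
    linarith

variable {n : ℕ} {N : ℝ → Seminorm ℝ (EuclideanSpace ℝ (Fin n))} {β : ℕ → ℝ}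

theorem pos_of_seminorm_le_mul [Nonempty (Fin n)] (hN : ∀ i, IsNorm (N (ξ i)))
    (hβ : ∀ j, 0 ≤ β j) (hswitch : ∀ j x, N (ξ (j + 1)) x ≤ β j * N (ξ j) x) (j : ℕ) :
    0 < β j := by
  obtain ⟨x, hx⟩ := (hN (j + 1)).exists_eq_one
  refine lt_of_le_of_ne (hβ j) fun h0 => ?_
  have := hswitch j x
  rw [hx, ← h0, zero_mul] at this
  linarith

/-- The product of the `β i` bounds the norm of mode `m` by that of mode `k`, and `D` leads back. On
a unit vector the two together give `1 ≤ (∏ β i) * D`, however many switches occur. -/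
theorem neg_log_le_sum_log [Nonempty (Fin n)] (hN : ∀ i, IsNorm (N (ξ i)))
    {D : ℝ} (hD : 0 < D) (hequiv : ∀ i j x, N (ξ i) x ≤ D * N (ξ j) x)
    (hβ : ∀ j, 0 < β j) (hswitch : ∀ j x, N (ξ (j + 1)) x ≤ β j * N (ξ j) x)
    {k m : ℕ} (hkm : k ≤ m) : -Real.log D ≤ ∑ i ∈ Finset.Ico k m, Real.log (β i) := by
  have h1 : ∀ x, N (ξ m) x ≤ (∏ i ∈ Finset.Ico k m, β i) * N (ξ k) x := by
    intro x
    induction m, hkm using Nat.le_induction with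
    | base => simp
    | succ m hm ih =>
      rw [Finset.prod_Ico_succ_top hm, mul_comm (Finset.prod _ _), mul_assoc]
      exact (hswitch m x).trans (mul_le_mul_of_nonneg_left ih (hβ m).le)
  obtain ⟨x, hx⟩ := (hN m).exists_eq_one
  have hP : 0 < ∏ i ∈ Finset.Ico k m, β i := Finset.prod_pos fun i _ => hβ i
  have h2 : 1 ≤ (∏ i ∈ Finset.Ico k m, β i) * D := by
    calc 1 = N (ξ m) x := hx.symm
      _ ≤ (∏ i ∈ Finset.Ico k m, β i) * (D * N (ξ m) x) :=
          (h1 x).trans (mul_le_mul_of_nonneg_left (hequiv _ _ _) hP.le)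
      _ = _ := by rw [hx, mul_one]
  have h3 := Real.log_nonneg h2
  rw [Real.log_mul hP.ne' hD.ne', Real.log_prod fun i _ => (hβ i).ne'] at h3
  linarith

end Exponents

/-! ### Exponential comparison functions and the degenerate dimension -/

section Stability

theorem isClassEKL_mul_exp {c K : ℝ} (hc : 0 < c) (hK : 0 < K) :
    IsClassEKL c fun ρ t => K * ρ * Real.exp (-c * t) := by
  refine ⟨⟨by fun_prop, fun ρ t hρ _ => by positivity, fun t _ => by simp, ?_, ?_, ?_⟩, ?_⟩
  · intro t _ ρ _ ρ' _ h
    have := Real.exp_pos (-c * t)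
    simp only
    gcongr
  · intro ρ hρ t _ t' _ h
    have h1 : -c * t' ≤ -c * t := mul_le_mul_of_nonpos_left h (neg_nonpos.2 hc.le)
    simp only
    gcongr
  · intro ρ _
    have h1 : Tendsto (fun t => -c * t) atTop atBot :=
      tendsto_id.const_mul_atTop_of_neg (neg_neg_of_pos hc)
    simpa using (Real.tendsto_exp_atBot.comp h1).const_mul (K * ρ)
  · intro ρ _
    exact Asymptotics.isBigO_const_mul_self _ _ _

variable {n : ℕ} {f : EuclideanSpace ℝ (Fin n) → ℝ → EuclideanSpace ℝ (Fin n)} {r : ℝ → ℝ}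
  {C : Set (EuclideanSpace ℝ (Fin n))} {c : ℝ}

theorem DeltaUEAS.deltaEAS (h : DeltaUEAS f r C c) : DeltaEAS f r C c := by
  obtain ⟨p, hp, b, hb, hbound⟩ := h
  exact ⟨p, hp, fun t₀ ht₀ => ⟨b, hb, hbound t₀ ht₀⟩⟩

/-- Dimension zero stands apart: no vector has norm `1`, so the induced norm of the identity is `0`
and the limit defining the matrix measure does not exist. -/
theorem deltaUEAS_of_subsingleton [Subsingleton (EuclideanSpace ℝ (Fin n))] (hc : 0 < c) :
    DeltaUEAS f r C c := by
  refine ⟨0, fun x _ => Subsingleton.elim _ _, _, isClassEKL_mul_exp hc one_pos,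
    fun t₀ _ x y _ _ _ _ t _ => ?_⟩
  simp

end Stability

/-! ### The two stability statements -/

theorem corollary1 {n : ℕ}
    (f : EuclideanSpace ℝ (Fin n) → ℝ → EuclideanSpace ℝ (Fin n)) (r : ℝ → ℝ)
    (C : Set (EuclideanSpace ℝ (Fin n))) (τ ξ : ℕ → ℝ)
    (N : ℝ → Seminorm ℝ (EuclideanSpace ℝ (Fin n)))
    (hr : IsStaircase r τ ξ) (hf : RegularField f r C)
    (hN : ∀ i, IsNorm (N (ξ i)))
    (hequiv : ∃ D : ℝ, 0 < D ∧ ∀ i j x, N (ξ i) x ≤ D * N (ξ j) x)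
    (hreach : ∀ t₀, 0 ≤ t₀ → ∃ κ : ℝ, 0 < κ ∧ IsReachable (N (r t₀)) κ C)
    (hinv : ForwardInvariant f r C)
    (α β : ℕ → ℝ) (hβ : ∀ j, 0 ≤ β j)
    (hα : ∀ j, ∀ x ∈ C, matrixMeasure (N (ξ j)) (fderiv ℝ (fun y => f y (ξ j)) x) ≤ α j)
    (hswitch : ∀ j x, N (ξ (j + 1)) x ≤ β j * N (ξ j) x)
    (c T₀ : ℝ) (hc : 0 < c) (hT₀ : 0 < T₀) :
    ((∃ t₀, 0 ≤ t₀ ∧ ∀ T, T₀ < T → 1 / T * totalExponent τ α β t₀ T < -c) →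
      DeltaEAS f r C c) ∧
    (BddBelow (Set.range α) →
      (∀ t₀, 0 ≤ t₀ → ∀ T, T₀ < T → 1 / T * totalExponent τ α β t₀ T < -c) →
      DeltaUEAS f r C c) := by
  rcases isEmpty_or_nonempty (Fin n) with hn | hn
  · exact ⟨fun _ => (deltaUEAS_of_subsingleton hc).deltaEAS,
      fun _ _ => deltaUEAS_of_subsingleton hc⟩
  obtain ⟨D, hD, hequiv⟩ := hequiv
  have hβ' := pos_of_seminorm_le_mul hN hβ hswitch
  -- Curves controlled in the norm of mode `0` serve every starting time, which makes the constant
  -- `D * D * κ` uniform.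
  obtain ⟨κ, hκ, hreach⟩ := hreach 0 le_rfl
  have hr0 : r 0 = ξ 0 := by
    refine hr.eq 0 0 ⟨hr.zero.le, ?_⟩
    nth_rewrite 1 [← hr.zero]
    exact hr.strictMono zero_lt_one
  rw [hr0] at hreach
  have hbound : ∀ M s k, s ∈ Ico (τ k) (τ (k + 1)) →
      (∀ t, 0 < t → ∀ m, s + t ∈ Ioc (τ m) (τ (m + 1)) →
        modeExponent τ α β m (s + t) - modeExponent τ α β k s ≤ M - c * t) →
      IncrementalBound f r C (N (ξ 0))
        (fun ρ t => (D * D * κ * Real.exp M + 1) * ρ * Real.exp (-c * t)) s := by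
    intro M s k hk hM x y hx hy hxC hyC t ht
    have hρ := apply_nonneg (N (ξ 0)) (x s - y s)
    -- At `t = 0` no exponent is available; the summand `1` in the constant covers this case.
    rcases ht.eq_or_lt with rfl | ht
    · simp only [add_zero, mul_zero, Real.exp_zero, mul_one]
      exact le_mul_of_one_le_left hρ (le_add_of_nonneg_left (by positivity))
    have hs : 0 ≤ s := (hr.nonneg k).trans hk.1
    obtain ⟨m, hm⟩ := hr.exists_mem_Ioc (t := s + t) (by positivity)
    calc N (ξ 0) (x (s + t) - y (s + t))
        ≤ D * D * κ * Real.exp (modeExponent τ α β m (s + t) - modeExponent τ α β k s)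
            * N (ξ 0) (x s - y s) :=
          hr.seminorm_solution_sub_le hf hN hD hequiv hreach hinv hβ' hα hswitch hk
            (le_add_of_nonneg_right ht.le)
            (hr.strictMono.mode_le hk.1 hm.2 (lt_add_of_pos_right s ht))
            (Ioc_subset_Icc_self hm) hx hy hxC hyC
      _ ≤ D * D * κ * Real.exp (M - c * t) * N (ξ 0) (x s - y s) := by
          have := Real.exp_le_exp.2 (hM t ht m hm)
          gcongr
      _ = D * D * κ * Real.exp M * N (ξ 0) (x s - y s) * Real.exp (-c * t) := by
          rw [sub_eq_add_neg, Real.exp_add, neg_mul]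
          ring
      _ ≤ _ := by
          refine mul_le_mul_of_nonneg_right (mul_le_mul_of_nonneg_right ?_ hρ) (Real.exp_pos _).le
          exact le_add_of_nonneg_right zero_le_one
  have htotal : ∀ s k T m, T₀ < T → s ∈ Ico (τ k) (τ (k + 1)) →
      s + T ∈ Ioc (τ m) (τ (m + 1)) → 1 / T * totalExponent τ α β s T < -c →
      modeExponent τ α β m (s + T) - modeExponent τ α β k s < -c * T := by
    intro s k T m hT hk hm h
    have hTpos : 0 < T := hT₀.trans hT
    rwa [hr.strictMono.totalExponent_eq α β hTpos hk hm, one_div_mul_eq_div,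
      div_lt_iff₀ hTpos] at h
  constructor
  · rintro ⟨t₁, ht₁, h⟩
    refine ⟨N (ξ 0), hN 0, fun s hs => ?_⟩
    obtain ⟨k, hk⟩ := hr.exists_mem_Ico hs
    obtain ⟨l, hl⟩ := hr.exists_mem_Ico ht₁
    obtain ⟨B, hB⟩ := hr.exists_modeExponent_le α β (t₁ + T₀)
    -- The first entry serves `s + t > t₁ + T₀`, where the condition from `t₁` applies and the
    -- exponents between `s` and `t₁` are a constant. The second serves earlier times, through the
    -- bound `B` and `t ≤ t₁ + T₀`.
    refine ⟨_, isClassEKL_mul_exp hc (by positivity), hbound (max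
      (modeExponent τ α β l t₁ - modeExponent τ α β k s + c * t₁)
      (B - modeExponent τ α β k s + c * (t₁ + T₀))) s k hk fun t ht m hm => ?_⟩
    rcases le_or_gt (s + t) (t₁ + T₀) with hle | hlt
    · have h1 := hB (s + t) hle m hm.1.le
      have h2 : c * t ≤ c * (t₁ + T₀) := by
        gcongr
        linarith
      linarith [le_max_right (modeExponent τ α β l t₁ - modeExponent τ α β k s + c * t₁)
        (B - modeExponent τ α β k s + c * (t₁ + T₀))]
    · have hT : T₀ < s + t - t₁ := by linarith
      have e : t₁ + (s + t - t₁) = s + t := by ring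
      have h1 := htotal t₁ l (s + t - t₁) m hT hl (by rwa [e]) (h _ hT)
      rw [e] at h1
      have h2 : 0 ≤ c * s := by positivity
      linarith [le_max_left (modeExponent τ α β l t₁ - modeExponent τ α β k s + c * t₁)
        (B - modeExponent τ α β k s + c * (t₁ + T₀))]
  · rintro ⟨a, ha⟩ h
    refine ⟨N (ξ 0), hN 0, _, isClassEKL_mul_exp hc
      (K := D * D * κ * Real.exp (|a| * (2 * T₀) + |Real.log D|) + 1) (by positivity),
      fun s hs => ?_⟩
    obtain ⟨k, hk⟩ := hr.exists_mem_Ico hs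
    refine hbound (|a| * (2 * T₀) + |Real.log D|) s k hk fun t ht m hm => ?_
    rcases le_or_gt t T₀ with hle | hlt
    -- For `t ≤ T₀` the exponent up to `s + t` is the one up to `s + 2 * T₀`, below `-c * (2 * T₀)`,
    -- minus the one from `s + t` on, which is at least `-(|a| * (2 * T₀)) - Real.log D`. The length
    -- `2 * T₀` is a fixed choice above `T₀`.
    · obtain ⟨m', hm'⟩ := hr.exists_mem_Ioc (t := s + 2 * T₀) (by positivity)
      have hT : T₀ < 2 * T₀ := by linarith
      have h1 := htotal s k (2 * T₀) m' hT hk hm' (h s hs _ hT)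
      have hmm' : m ≤ m' := hr.strictMono.mode_le hm.1.le hm'.2 (by linarith)
      have h2 := hr.strictMono.le_modeExponent_sub (β := β) (fun i => ha (mem_range_self i)) hmm'
        hm.2 (s + 2 * T₀) (by linarith) hm'.1.le
      have h3 := neg_log_le_sum_log hN hD hequiv hβ' hswitch hmm'
      have h4 : -(|a| * (2 * T₀)) ≤ a * (s + 2 * T₀ - (s + t)) := by
        have h5 : |a * (s + 2 * T₀ - (s + t))| ≤ |a| * (2 * T₀) := by
          rw [abs_mul]
          gcongr
          rw [abs_le]
          constructor <;> linarith
        linarith [neg_abs_le (a * (s + 2 * T₀ - (s + t)))]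
      have h6 : c * t ≤ c * (2 * T₀) := by
        gcongr
        linarith
      linarith [le_abs_self (Real.log D)]
    · have h1 := htotal s k t m hlt hk hm (h s hs t hlt)
      have h2 : 0 ≤ |a| * (2 * T₀) := by positivity
      linarith [abs_nonneg (Real.log D)]
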